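/- All manifolds are smooth, real, finite-dimensional and without boundary. Let $(G,\omega)$ be a connected symplectic Lie group, i.e. a connected Lie group $G$ with a left-invariant symplectic form $\omega$, and let $\mathrm{Aut}(G,\omega)$ be the Lie group of Lie group automorphisms $\varphi$ of $G$ with $\varphi^*\omega=\omega$ (its Lie group structure is the one it has as a closed subgroup of $GL(\mathfrak g)$ through the embedding $\varphi\mapsto\varphi_*=(d\varphi)_e$). Let $\pi:E\to M$ be a smooth fibre bundle with fibre $G$. A *system of local trivializations* of $\pi$ is a family of diffeomorphisms $\psi_i:\pi^{-1}(U_i)\to U_i\times G$ over the identity of $U_i$, where the open sets $U_i$ cover $M$; for $p\in U_i$ let $\psi_{i,p}:E_p\to G$ be the induced map on the fibre $E_p=\pi^{-1}(p)$. A *symplectic Lie group bundle (SLGB) structure* on $\pi$, with fibre $(G,\omega)$, consists of a smooth section $\widetilde\omega$ of $\wedge^2(\ker\pi_*)^*$ and, for every $p\in M$, a Lie group structure on $E_p$ whose manifold structure is that of $E_p$ as an embedded submanifold of $E$, such that * for every $p\in M$ the form $\gamma_p^*\widetilde\omega$ is a left-invariant symplectic form on $E_p$, where $\gamma_p:T(E_p)\hookrightarrow\ker\pi_*$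 is the inclusion; * there is a system of local trivializations $\{\psi_i\}$ of $\pi$ such that, for all $i$ and $p\in U_i$, $\psi_{i,p}:(E_p,\gamma_p^*\widetilde\omega)\to(G,\omega)$ is an isomorphism of symplectic Lie groups, i.e. a Lie group isomorphism with $\psi_{i,p}^*\omega=\gamma_p^*\widetilde\omega$. **Theorem.** The bundle $\pi:E\to M$ admits an SLGB structure with fibre $(G,\omega)$ if and only if there is a system of local trivializations $\{\psi_i\}$ of $\pi$ all of whose transition functions $\phi_{ji}$, given by $\psi_j\circ\psi_i^{-1}(p,g)=(p,\phi_{ji}(p)(g))$ for $p\in U_i\cap U_j$ and $g\in G$, take their values in the Lie group $\mathrm{Aut}(G,\omega)$. This equivalence holds both when the $\phi_{ji}$ are only required to be maps $U_i\cap U_j\to\mathrm{Aut}(G,\omega)$ and when they are moreover required to be smooth as maps into the Lie group $\mathrm{Aut}(G,\omega)$. -/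

import Mathlib

open Set Manifold
open scoped Manifold ContDiff

noncomputable section

namespace SLG

section Forms

variable {V : Type*} [NormedAddCommGroup V] [NormedSpace ℝ V]
  {N : Type*} [TopologicalSpace N] [ChartedSpace V N]
  {V' : Type*} [NormedAddCommGroup V'] [NormedSpace ℝ V']
  {N' : Type*} [TopologicalSpace N'] [ChartedSpace V' N']

variable (V N) in
/-- A (not necessarily smooth) field of bilinear forms on the tangent spaces of a manifold `N`
modelled on `V`. -/
abbrev BilinField : Type _ := ∀ x : N, LinearMap.BilinForm ℝ (TangentSpace 𝓘(ℝ, V) x)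

/-- The pullback of a field of bilinear forms: `(f^* θ)_x (u, v) = θ_{f x} (f_* u, f_* v)`. -/
def BilinField.pullback (f : N → N') (θ : BilinField V' N') : BilinField V N := fun x =>
  (θ (f x)).compl₁₂ (mfderiv 𝓘(ℝ, V) 𝓘(ℝ, V') f x).toLinearMap
    (mfderiv 𝓘(ℝ, V) 𝓘(ℝ, V') f x).toLinearMap

theorem BilinField.pullback_comp {W : Type*} [NormedAddCommGroup W] [NormedSpace ℝ W]
    {K : Type*} [TopologicalSpace K] [ChartedSpace W K]
    (θ : BilinField W K) {f : N' → K} {g : N → N'}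
    (hf : ContMDiff 𝓘(ℝ, V') 𝓘(ℝ, W) ∞ f) (hg : ContMDiff 𝓘(ℝ, V) 𝓘(ℝ, V') ∞ g) :
    BilinField.pullback (V := V) (f ∘ g) θ =
      BilinField.pullback (V := V) g (BilinField.pullback (V := V') f θ) := by
  funext x
  ext u v
  have h := mfderiv_comp x (hf.mdifferentiable (by simp) (g x)) (hg.mdifferentiable (by simp) x)
  simp [BilinField.pullback, h]

theorem BilinField.pullback_id (θ : BilinField V N) :
    BilinField.pullback (V := V) (fun x : N => x) θ = θ := by
  funext x
  ext u v
  have h : mfderiv 𝓘(ℝ, V) 𝓘(ℝ, V) (fun x : N => x) x = ContinuousLinearMap.id ℝ _ := mfderiv_id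
  simp [BilinField.pullback, h]

/-- The vector field `X` is smooth on the set `U`. -/
def SmoothFieldOn [IsManifold 𝓘(ℝ, V) ∞ N] (X : ∀ x : N, TangentSpace 𝓘(ℝ, V) x) (U : Set N) : Prop :=
  ContMDiffOn 𝓘(ℝ, V) 𝓘(ℝ, V).tangent ∞ (fun x => (⟨x, X x⟩ : TangentBundle 𝓘(ℝ, V) N)) U

/-- A differential `2`-form: alternating, and smooth on every pair of local smooth vector
fields. -/
structure IsTwoForm [IsManifold 𝓘(ℝ, V) ∞ N] (θ : BilinField V N) : Prop where
  alt : ∀ x, (θ x).IsAlt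
  smooth : ∀ (U : Set N), IsOpen U → ∀ X Y : (∀ x : N, TangentSpace 𝓘(ℝ, V) x),
    SmoothFieldOn X U → SmoothFieldOn Y U →
    ContMDiffOn 𝓘(ℝ, V) 𝓘(ℝ, ℝ) ∞ (fun x => θ x (X x) (Y x)) U

/-- The exterior derivative of `θ`, evaluated at `x` on three vector fields. -/
def extDerivAt (θ : BilinField V N) (X Y Z : ∀ x : N, TangentSpace 𝓘(ℝ, V) x) (x : N) : ℝ :=
  mvfderiv 𝓘(ℝ, V) (fun y => θ y (Y y) (Z y)) x (X x)
    - mvfderiv 𝓘(ℝ, V) (fun y => θ y (X y) (Z y)) x (Y x)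
    + mvfderiv 𝓘(ℝ, V) (fun y => θ y (X y) (Y y)) x (Z x)
    - θ x (VectorField.mlieBracket 𝓘(ℝ, V) X Y x) (Z x)
    + θ x (VectorField.mlieBracket 𝓘(ℝ, V) X Z x) (Y x)
    - θ x (VectorField.mlieBracket 𝓘(ℝ, V) Y Z x) (X x)

/-- A symplectic form: a closed, non-degenerate differential `2`-form. -/
structure IsSymplecticForm [IsManifold 𝓘(ℝ, V) ∞ N] (θ : BilinField V N) : Prop extends IsTwoForm θ where
  closed : ∀ (U : Set N), IsOpen U → ∀ X Y Z : (∀ x : N, TangentSpace 𝓘(ℝ, V) x),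
    SmoothFieldOn X U → SmoothFieldOn Y U → SmoothFieldOn Z U →
    ∀ x ∈ U, extDerivAt θ X Y Z x = 0
  nondegenerate : ∀ (x : N) (u : TangentSpace 𝓘(ℝ, V) x), (∀ v, θ x u v = 0) → u = 0

end Forms

section Groups

variable {V : Type*} [NormedAddCommGroup V] [NormedSpace ℝ V]
  {G : Type*} [TopologicalSpace G] [ChartedSpace V G] [Group G]
  {V' : Type*} [NormedAddCommGroup V'] [NormedSpace ℝ V']
  {G' : Type*} [TopologicalSpace G'] [ChartedSpace V' G'] [Group G']

/-- A left-invariant symplectic form on `G`. For a Lie group `G`, this says that `(G, θ)` is a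
symplectic Lie group. -/
structure IsLeftInvariantSymplectic [IsManifold 𝓘(ℝ, V) ∞ G] (θ : BilinField V G) : Prop extends IsSymplecticForm θ where
  left_invariant : ∀ g : G, BilinField.pullback (fun x : G => g * x) θ = θ

/-- The group isomorphism `φ` is an isomorphism `(G, θ) → (G', θ')` of symplectic Lie groups:
a diffeomorphism with `φ^* θ' = θ`. -/
structure IsSymplecticIso (θ : BilinField V G) (θ' : BilinField V' G') (φ : G ≃* G') : Prop where
  smooth : ContMDiff 𝓘(ℝ, V) 𝓘(ℝ, V') ∞ φ
  smooth_symm : ContMDiff 𝓘(ℝ, V') 𝓘(ℝ, V) ∞ φ.symm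
  pullback_eq : BilinField.pullback (φ : G → G') θ' = θ

/-- The group `Aut(G, θ)` of automorphisms of the symplectic Lie group `(G, θ)`. -/
def symplecticAut (θ : BilinField V G) : Subgroup (MulAut G) where
  carrier := {φ | IsSymplecticIso θ θ φ}
  one_mem' := ⟨contMDiff_id, contMDiff_id, BilinField.pullback_id θ⟩
  mul_mem' := by
    intro φ ψ hφ hψ
    refine ⟨hφ.smooth.comp hψ.smooth, hψ.smooth_symm.comp hφ.smooth_symm, ?_⟩
    have h := BilinField.pullback_comp θ hφ.smooth hψ.smooth
    rw [hφ.pullback_eq, hψ.pullback_eq] at h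
    exact h
  inv_mem' := by
    intro φ hφ
    refine ⟨hφ.smooth_symm, hφ.smooth, ?_⟩
    have h := BilinField.pullback_comp θ hφ.smooth hφ.smooth_symm
    rw [hφ.pullback_eq] at h
    have h2 : (φ : G → G) ∘ (φ.symm : G → G) = fun x => x := by
      funext x
      simp
    rw [h2, BilinField.pullback_id] at h
    exact h.symm

/-- The map `Aut(G) → gl(𝔤)`, `φ ↦ φ_* = (dφ)_e`, where `𝔤 = T_e G` is the model space `V`. For
connected `G` it is injective on smooth automorphisms, and identifies `Aut(G, θ)` with a closed
subgroup of `GL(𝔤)`; this is what defines the Lie group structure of `Aut(G, θ)`. -/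
def lieAlgebraMap (φ : MulAut G) : V →L[ℝ] V :=
  mfderiv 𝓘(ℝ, V) 𝓘(ℝ, V) (φ : G → G) (1 : G)

end Groups

section Bundles

variable {VG : Type*} [NormedAddCommGroup VG] [NormedSpace ℝ VG]
  {G : Type*} [TopologicalSpace G] [ChartedSpace VG G]
  {VM : Type*} [NormedAddCommGroup VM] [NormedSpace ℝ VM]
  {M : Type*} [TopologicalSpace M] [ChartedSpace VM M]
  {VE : Type*} [NormedAddCommGroup VE] [NormedSpace ℝ VE]
  {E : Type*} [TopologicalSpace E] [ChartedSpace VE E]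

variable (VG VM VE) in
/-- A local trivialization `e : π⁻¹(U) → U × G` over the open set `U = e.baseSet` is smooth if it
is a diffeomorphism. -/
structure IsSmoothTriv {π : E → M} (e : Bundle.Trivialization G π) : Prop where
  smooth : ContMDiffOn 𝓘(ℝ, VE) (𝓘(ℝ, VM).prod 𝓘(ℝ, VG)) ∞ e (π ⁻¹' e.baseSet)
  smooth_symm : ContMDiffOn (𝓘(ℝ, VM).prod 𝓘(ℝ, VG)) 𝓘(ℝ, VE) ∞
    e.toOpenPartialHomeomorph.symm (e.baseSet ×ˢ univ)

variable (VG VM VE) in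
/-- A system of (smooth) local trivializations: their domains cover the base. -/
structure IsTrivSystem {π : E → M} (A : Set (Bundle.Trivialization G π)) : Prop where
  smooth : ∀ e ∈ A, IsSmoothTriv VG VM VE e
  cover : ∀ p : M, ∃ e ∈ A, p ∈ e.baseSet

variable (VG VM VE G) in
/-- `π : E → M` is a smooth fibre bundle with fibre `G`. -/
structure IsSmoothFiberBundle (π : E → M) : Prop where
  smooth : ContMDiff 𝓘(ℝ, VE) 𝓘(ℝ, VM) ∞ π
  locally_trivial : ∀ p : M, ∃ e : Bundle.Trivialization G π, p ∈ e.baseSet ∧ IsSmoothTriv VG VM VE e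

variable (VM VE) in
/-- The fibre at `x` of the vertical bundle `ker π_*`. -/
def Vertical (π : E → M) (x : E) : Submodule ℝ (TangentSpace 𝓘(ℝ, VE) x) :=
  (mfderiv 𝓘(ℝ, VE) 𝓘(ℝ, VM) π x).ker

/-- A smooth section of `⋀² (ker π_*)^*`: alternating at each point, and smooth on every pair of
local smooth sections of `ker π_*`. -/
structure IsVerticalTwoForm [IsManifold 𝓘(ℝ, VE) ∞ E] {π : E → M}
    (σ : ∀ x : E, LinearMap.BilinForm ℝ (Vertical VM VE π x)) : Prop where
  alt : ∀ x, (σ x).IsAlt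
  smooth : ∀ (U : Set E), IsOpen U → ∀ X Y : (∀ x : E, Vertical VM VE π x),
    SmoothFieldOn (fun x => (X x : TangentSpace 𝓘(ℝ, VE) x)) U →
    SmoothFieldOn (fun x => (Y x : TangentSpace 𝓘(ℝ, VE) x)) U →
    ContMDiffOn 𝓘(ℝ, VE) 𝓘(ℝ, ℝ) ∞ (fun x => σ x (X x) (Y x)) U

/-- The inclusion `γ_p : T(E_p) → ker π_*`, at a point `x` of the fibre `E_p`, for a manifold
structure on `E_p` such that the inclusion `E_p → E` is smooth. -/
def fiberInclusion {π : E → M} (hπ : ContMDiff 𝓘(ℝ, VE) 𝓘(ℝ, VM) ∞ π) (p : M)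
    [ChartedSpace VG (π ⁻¹' {p})]
    (hι : ContMDiff 𝓘(ℝ, VG) 𝓘(ℝ, VE) ∞ (Subtype.val : π ⁻¹' {p} → E)) (x : π ⁻¹' {p}) :
    TangentSpace 𝓘(ℝ, VG) x →ₗ[ℝ] Vertical VM VE π x :=
  LinearMap.codRestrict (Vertical VM VE π x)
    (mfderiv 𝓘(ℝ, VG) 𝓘(ℝ, VE) (Subtype.val : π ⁻¹' {p} → E) x).toLinearMap <| by
    intro u
    have h := mfderiv_comp x (hπ.mdifferentiable (by simp) (x : E))
      (hι.mdifferentiable (by simp) x)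
    have hc : π ∘ (Subtype.val : π ⁻¹' {p} → E) = fun _ => p := by
      funext y
      exact y.2
    rw [hc, mfderiv_const] at h
    exact (congrArg (fun T => T u) h).symm

/-- The restriction `γ_p^* σ` to the fibre `E_p` of a field `σ` of bilinear forms on `ker π_*`. -/
def restrictToFiber {π : E → M} (hπ : ContMDiff 𝓘(ℝ, VE) 𝓘(ℝ, VM) ∞ π)
    (σ : ∀ x : E, LinearMap.BilinForm ℝ (Vertical VM VE π x)) (p : M)
    [ChartedSpace VG (π ⁻¹' {p})]
    (hι : ContMDiff 𝓘(ℝ, VG) 𝓘(ℝ, VE) ∞ (Subtype.val : π ⁻¹' {p} → E)) :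
    BilinField VG (π ⁻¹' {p}) := fun x =>
  (σ x).compl₁₂ (fiberInclusion hπ p hι x) (fiberInclusion hπ p hι x)

/-- The structure of a symplectic Lie group bundle, with fibre the symplectic Lie group `(G, θ)`,
on a smooth fibre bundle `π : E → M`. The fibres carry their manifold structure as embedded
submanifolds of `E` (it is unique, and modelled on `VG` since the fibres are diffeomorphic to
`G`). -/
structure SLGBStructure [IsManifold 𝓘(ℝ, VE) ∞ E] [Group G] (θ : BilinField VG G) (π : E → M)
    (hπ : IsSmoothFiberBundle VG G VM VE π) where
  fiberGroup : ∀ p : M, Group (π ⁻¹' {p})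
  fiberCharts : ∀ p : M, ChartedSpace VG (π ⁻¹' {p})
  fiber_lieGroup : ∀ p : M, LieGroup 𝓘(ℝ, VG) ∞ (π ⁻¹' {p})
  fiber_embedded : ∀ p : M,
    IsSmoothEmbedding 𝓘(ℝ, VG) 𝓘(ℝ, VE) ∞ (Subtype.val : π ⁻¹' {p} → E)
  /-- The section of `⋀² (ker π_*)^*`. -/
  form : ∀ x : E, LinearMap.BilinForm ℝ (Vertical VM VE π x)
  form_smooth : IsVerticalTwoForm form
  fiber_symplectic : ∀ p : M, IsLeftInvariantSymplectic
    (restrictToFiber hπ.smooth form p (fiber_embedded p).contMDiff)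
  exists_triv : ∃ A : Set (Bundle.Trivialization G π), IsTrivSystem VG VM VE A ∧
    ∀ e ∈ A, ∀ p ∈ e.baseSet, ∃ φ : (π ⁻¹' {p}) ≃* G,
      (∀ x : π ⁻¹' {p}, φ x = (e (x : E)).2) ∧
      IsSymplecticIso (restrictToFiber hπ.smooth form p (fiber_embedded p).contMDiff) θ φ

/-- `τ` is the transition function from `e` to `e'`, with values in the group `K` of automorphisms
of `G`: `e' ∘ e⁻¹ (p, g) = (p, τ(p) g)` for `p ∈ U ∩ U'` and `g ∈ G`. -/
def IsTransitionFunction [Group G] {π : E → M} (e e' : Bundle.Trivialization G π)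
    {K : Subgroup (MulAut G)} (τ : (e.baseSet ∩ e'.baseSet : Set M) → K) : Prop :=
  ∀ (p : (e.baseSet ∩ e'.baseSet : Set M)) (g : G),
    e' (e.toOpenPartialHomeomorph.symm ((p : M), g)) = ((p : M), (τ p : MulAut G) g)

/-- A map `τ` from an open subset `W` of `M` to the Lie group `Aut(G, θ)` (`G` connected) is
smooth if it is so as a map to the vector space `gl(𝔤)`, in which `Aut(G, θ)` is embedded. -/
def IsSmoothIntoAut [Group G] {θ : BilinField VG G} (W : Set M) (hW : IsOpen W)
    (τ : W → symplecticAut θ) : Prop :=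
  ContMDiff (M := (⟨W, hW⟩ : TopologicalSpace.Opens M)) 𝓘(ℝ, VM) 𝓘(ℝ, VG →L[ℝ] VG) ∞
    (fun p => lieAlgebraMap (V := VG) (τ p : MulAut G))

end Bundles

end SLG

end

noncomputable section

namespace SLG

/-! ### Naturality of symplectic forms under diffeomorphisms -/

section PullbackForms

variable {V : Type*} [NormedAddCommGroup V] [NormedSpace ℝ V]
  {N : Type*} [TopologicalSpace N] [ChartedSpace V N]
  {V' : Type*} [NormedAddCommGroup V'] [NormedSpace ℝ V']
  {N' : Type*} [TopologicalSpace N'] [ChartedSpace V' N']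

/-! From a bundle structure to transition functions, the argument is fibrewise: `φ_ji(p) = ψ_{j,p} ∘
ψ_{i,p}⁻¹` is a composite of symplectic isomorphisms, hence lies in `Aut(G, θ)`
(`exists_isTransitionFunction`). Smoothness comes for free: `(p, g) ↦ φ_ji(p)(g)` is a component of
a change of smooth trivializations, so its partial derivative in `g` at the identity, which is
`φ_ji(p)_*`, is smooth in `p` (`IsTransitionFunction.isSmoothIntoAut`). This is why the two readings
of the theorem agree.

Conversely, transport the group, the charts and the form of `G` to each fibre by one chosen
trivialization. On vertical vectors two fibre coordinates differ only by the differential of the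
automorphism `φ_ji(p)`, with no contribution from varying `p`; since this automorphism preserves
`θ`, the vertical form does not depend on the choice (`verticalForm_congr`). Around each point it is
therefore the pullback of `θ` by a single smooth fibre coordinate, and left invariance reduces its
smoothness to that of the pulled-back Maurer-Cartan form (`contMDiffAt_pullback_apply`). On a fibre
it is the pullback of `θ` by a Lie group isomorphism, hence left-invariant symplectic
(`IsLeftInvariantSymplectic.pullback`); embeddedness is read in a chart adapted to the
trivialization (`isSmoothEmbedding_fiber`). -/

theorem BilinField.pullback_apply (f : N → N') (θ : BilinField V' N') (x : N)
    (u v : TangentSpace 𝓘(ℝ, V) x) :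
    BilinField.pullback (V := V) f θ x u v =
      θ (f x) (mfderiv 𝓘(ℝ, V) 𝓘(ℝ, V') f x u) (mfderiv 𝓘(ℝ, V) 𝓘(ℝ, V') f x v) := rfl

theorem isInvertible_mfderiv_diffeomorph (Φ : N ≃ₘ^∞⟮𝓘(ℝ, V), 𝓘(ℝ, V')⟯ N') (x : N) :
    (mfderiv 𝓘(ℝ, V) 𝓘(ℝ, V') Φ x).IsInvertible :=
  ⟨Φ.mfderivToContinuousLinearEquiv (by simp) x, rfl⟩

/-- The push-forward of a vector field along a diffeomorphism. -/
def pushforwardField (Φ : N ≃ₘ^∞⟮𝓘(ℝ, V), 𝓘(ℝ, V')⟯ N')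
    (X : ∀ x : N, TangentSpace 𝓘(ℝ, V) x) (y : N') : TangentSpace 𝓘(ℝ, V') y :=
  VectorField.mpullback 𝓘(ℝ, V') 𝓘(ℝ, V) Φ.symm X y

/-- Differentiating `Φ ∘ Φ.symm = id` identifies the inverse of the differential of `Φ.symm`, used
to define the push-forward, with the differential of `Φ`. -/
theorem pushforwardField_apply (Φ : N ≃ₘ^∞⟮𝓘(ℝ, V), 𝓘(ℝ, V')⟯ N')
    (X : ∀ x : N, TangentSpace 𝓘(ℝ, V) x) (x : N) :
    pushforwardField Φ X (Φ x) = mfderiv 𝓘(ℝ, V) 𝓘(ℝ, V') Φ x (X x) := by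
  have hx : Φ.symm (Φ x) = x := Φ.symm_apply_apply x
  have hc : mfderiv 𝓘(ℝ, V) 𝓘(ℝ, V') Φ x (X x) =
      mfderiv 𝓘(ℝ, V) 𝓘(ℝ, V') Φ (Φ.symm (Φ x)) (X (Φ.symm (Φ x))) := by
    rw! [hx]; rfl
  rw [hc, pushforwardField, VectorField.mpullback_apply]
  have hcomp := mfderiv_comp (Φ x) (Φ.mdifferentiable (by simp) (Φ.symm (Φ x)))
    (Φ.symm.mdifferentiable (by simp) (Φ x))
  have hid : (Φ : N → N') ∘ Φ.symm = id := by
    funext y; simp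
  rw [hid, mfderiv_id] at hcomp
  obtain ⟨A, hA⟩ := isInvertible_mfderiv_diffeomorph Φ.symm (Φ x)
  rw [← hA] at hcomp ⊢
  rw [ContinuousLinearMap.inverse_equiv]
  have hv : A.symm (X (Φ.symm (Φ x))) =
      mfderiv 𝓘(ℝ, V) 𝓘(ℝ, V') Φ (Φ.symm (Φ x)) (A (A.symm (X (Φ.symm (Φ x))))) :=
    congrArg (fun T => T (A.symm (X (Φ.symm (Φ x))))) hcomp
  rw [A.apply_symm_apply] at hv
  exact hv

theorem mpullback_pushforwardField (Φ : N ≃ₘ^∞⟮𝓘(ℝ, V), 𝓘(ℝ, V')⟯ N')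
    (X : ∀ x : N, TangentSpace 𝓘(ℝ, V) x) :
    VectorField.mpullback 𝓘(ℝ, V) 𝓘(ℝ, V') Φ (pushforwardField Φ X) = X := by
  funext x
  rw [VectorField.mpullback_apply, pushforwardField_apply]
  obtain ⟨A, hA⟩ := isInvertible_mfderiv_diffeomorph Φ x
  rw [← hA, ContinuousLinearMap.inverse_equiv]
  exact A.symm_apply_apply _

theorem pullback_apply_fields (Φ : N ≃ₘ^∞⟮𝓘(ℝ, V), 𝓘(ℝ, V')⟯ N') (θ : BilinField V' N')
    (X Y : ∀ x : N, TangentSpace 𝓘(ℝ, V) x) (x : N) :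
    BilinField.pullback (V := V) Φ θ x (X x) (Y x) =
      θ (Φ x) (pushforwardField Φ X (Φ x)) (pushforwardField Φ Y (Φ x)) := by
  rw [pushforwardField_apply, pushforwardField_apply, BilinField.pullback_apply]

theorem mvfderiv_comp_apply (Φ : N ≃ₘ^∞⟮𝓘(ℝ, V), 𝓘(ℝ, V')⟯ N') {f : N' → ℝ} {x : N}
    (hf : MDifferentiableAt 𝓘(ℝ, V') 𝓘(ℝ, ℝ) f (Φ x)) (u : TangentSpace 𝓘(ℝ, V) x) :
    mvfderiv 𝓘(ℝ, V) (fun y => f (Φ y)) x u =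
      mvfderiv 𝓘(ℝ, V') f (Φ x) (mfderiv 𝓘(ℝ, V) 𝓘(ℝ, V') Φ x u) := by
  have h := mfderiv_comp x hf (Φ.mdifferentiable (by simp) x)
  exact congrArg (fun T => T u) h

variable [IsManifold 𝓘(ℝ, V) ∞ N] [IsManifold 𝓘(ℝ, V') ∞ N']

theorem SmoothFieldOn.pushforward [CompleteSpace V'] (Φ : N ≃ₘ^∞⟮𝓘(ℝ, V), 𝓘(ℝ, V')⟯ N')
    {X : ∀ x : N, TangentSpace 𝓘(ℝ, V) x} {U : Set N} (hX : SmoothFieldOn X U) :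
    SmoothFieldOn (pushforwardField Φ X) (Φ.symm ⁻¹' U) :=
  ContMDiffOn.mpullback_vectorField_preimage hX Φ.symm.contMDiff
    (fun y _ => isInvertible_mfderiv_diffeomorph Φ.symm y) (by simp)

/-- Smoothness is tested on vector fields, so the test fields on `U` are pushed forward to test
fields on the image of `U`. -/
theorem IsTwoForm.pullback [CompleteSpace V'] {θ : BilinField V' N'} (hθ : IsTwoForm θ)
    (Φ : N ≃ₘ^∞⟮𝓘(ℝ, V), 𝓘(ℝ, V')⟯ N') : IsTwoForm (BilinField.pullback (V := V) Φ θ) where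
  alt x u := hθ.alt _ _
  smooth U hU X Y hX hY := by
    have h := hθ.smooth (Φ.symm ⁻¹' U) (hU.preimage Φ.symm.continuous) _ _
      (hX.pushforward Φ) (hY.pushforward Φ)
    have h2 := h.comp (Φ.contMDiff.contMDiffOn (s := U)) (fun x hx => by simpa using hx)
    exact h2.congr fun x _ => pullback_apply_fields Φ θ X Y x

theorem mfderiv_mlieBracket [CompleteSpace V] [CompleteSpace V']
    (Φ : N ≃ₘ^∞⟮𝓘(ℝ, V), 𝓘(ℝ, V')⟯ N')
    {X Y : ∀ x : N, TangentSpace 𝓘(ℝ, V) x} {U : Set N} (hU : IsOpen U)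
    (hX : SmoothFieldOn X U) (hY : SmoothFieldOn Y U) {x : N} (hx : x ∈ U) :
    mfderiv 𝓘(ℝ, V) 𝓘(ℝ, V') Φ x (VectorField.mlieBracket 𝓘(ℝ, V) X Y x) =
      VectorField.mlieBracket 𝓘(ℝ, V') (pushforwardField Φ X) (pushforwardField Φ Y) (Φ x) := by
  have h2 : minSmoothness ℝ 2 ≤ ∞ := by
    rw [minSmoothness_of_isRCLikeNormedField]
    exact ENat.LEInfty.out
  have : IsManifold 𝓘(ℝ, V) (minSmoothness ℝ 2) N := IsManifold.of_le h2
  have : IsManifold 𝓘(ℝ, V') (minSmoothness ℝ 2) N' := IsManifold.of_le h2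
  have hU' : Φ.symm ⁻¹' U ∈ nhds (Φ x) :=
    (hU.preimage Φ.symm.continuous).mem_nhds (by simpa using hx)
  have hX' := ((hX.pushforward Φ).contMDiffAt hU').mdifferentiableAt (by simp)
  have hY' := ((hY.pushforward Φ).contMDiffAt hU').mdifferentiableAt (by simp)
  have h := VectorField.mpullback_mlieBracket (n := ∞) hX' hY' Φ.contMDiff.contMDiffAt h2
  rw [mpullback_pushforwardField, mpullback_pushforwardField, VectorField.mpullback_apply] at h
  rw [← h]
  obtain ⟨A, hA⟩ := isInvertible_mfderiv_diffeomorph Φ x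
  rw [← hA, ContinuousLinearMap.inverse_equiv]
  exact A.apply_symm_apply _

/-- The three derivative terms transform by the chain rule, the three bracket terms by naturality of
the Lie bracket (`mfderiv_mlieBracket`). -/
theorem extDerivAt_pullback [CompleteSpace V] [CompleteSpace V']
    {θ : BilinField V' N'} (hθ : IsTwoForm θ) (Φ : N ≃ₘ^∞⟮𝓘(ℝ, V), 𝓘(ℝ, V')⟯ N')
    {X Y Z : ∀ x : N, TangentSpace 𝓘(ℝ, V) x} {U : Set N} (hU : IsOpen U)
    (hX : SmoothFieldOn X U) (hY : SmoothFieldOn Y U) (hZ : SmoothFieldOn Z U) {x : N}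
    (hx : x ∈ U) :
    extDerivAt (BilinField.pullback (V := V) Φ θ) X Y Z x =
      extDerivAt θ (pushforwardField Φ X) (pushforwardField Φ Y) (pushforwardField Φ Z) (Φ x) := by
  have hO := hU.preimage Φ.symm.continuous
  have hU' : Φ.symm ⁻¹' U ∈ nhds (Φ x) := hO.mem_nhds (by simpa using hx)
  have hd : ∀ A B : (∀ x : N, TangentSpace 𝓘(ℝ, V) x), SmoothFieldOn A U → SmoothFieldOn B U →
      MDifferentiableAt 𝓘(ℝ, V') 𝓘(ℝ, ℝ)
        (fun y => θ y (pushforwardField Φ A y) (pushforwardField Φ B y)) (Φ x) :=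
    fun A B hA hB => ((hθ.smooth _ hO _ _ (hA.pushforward Φ)
      (hB.pushforward Φ)).contMDiffAt hU').mdifferentiableAt (by simp)
  have key : ∀ A B C : (∀ x : N, TangentSpace 𝓘(ℝ, V) x), SmoothFieldOn A U →
      SmoothFieldOn B U →
      mvfderiv 𝓘(ℝ, V) (fun y => BilinField.pullback (V := V) Φ θ y (A y) (B y)) x (C x) =
      mvfderiv 𝓘(ℝ, V') (fun y => θ y (pushforwardField Φ A y) (pushforwardField Φ B y)) (Φ x)
        (pushforwardField Φ C (Φ x)) := by
    intro A B C hA hB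
    rw [pushforwardField_apply, ← mvfderiv_comp_apply Φ (hd A B hA hB)]
    simp_rw [pullback_apply_fields]
  unfold extDerivAt
  rw [key Y Z X hY hZ, key X Z Y hX hZ, key X Y Z hX hY]
  simp only [BilinField.pullback_apply]
  rw [mfderiv_mlieBracket Φ hU hX hY hx, mfderiv_mlieBracket Φ hU hX hZ hx,
    mfderiv_mlieBracket Φ hU hY hZ hx, ← pushforwardField_apply, ← pushforwardField_apply,
    ← pushforwardField_apply]

theorem IsSymplecticForm.pullback [CompleteSpace V] [CompleteSpace V']
    {θ : BilinField V' N'} (hθ : IsSymplecticForm θ)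
    (Φ : N ≃ₘ^∞⟮𝓘(ℝ, V), 𝓘(ℝ, V')⟯ N') :
    IsSymplecticForm (BilinField.pullback (V := V) Φ θ) where
  toIsTwoForm := hθ.toIsTwoForm.pullback Φ
  closed U hU X Y Z hX hY hZ x hx := by
    rw [extDerivAt_pullback hθ.toIsTwoForm Φ hU hX hY hZ hx]
    exact hθ.closed _ (hU.preimage Φ.symm.continuous) _ _ _ (hX.pushforward Φ)
      (hY.pushforward Φ) (hZ.pushforward Φ) _ (by simpa using hx)
  nondegenerate x u hu := by
    obtain ⟨A, hA⟩ := isInvertible_mfderiv_diffeomorph Φ x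
    have h0 : A u = 0 := by
      refine hθ.nondegenerate (Φ x) (A u) fun v => ?_
      have := hu (A.symm v)
      rw [BilinField.pullback_apply, ← hA] at this
      simpa using! this
    simpa using! h0

end PullbackForms

/-! ### Isomorphisms of symplectic Lie groups -/

section PullbackGroups

variable {V : Type*} [NormedAddCommGroup V] [NormedSpace ℝ V]
  {N : Type*} [TopologicalSpace N] [ChartedSpace V N] [Group N]
  {V' : Type*} [NormedAddCommGroup V'] [NormedSpace ℝ V']
  {N' : Type*} [TopologicalSpace N'] [ChartedSpace V' N'] [Group N']
  {W : Type*} [NormedAddCommGroup W] [NormedSpace ℝ W]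
  {K : Type*} [TopologicalSpace K] [ChartedSpace W K] [Group K]

/-- Left invariance is inherited because `φ ∘ L_g = L_{φ g} ∘ φ`. -/
theorem IsLeftInvariantSymplectic.pullback [CompleteSpace V] [CompleteSpace V']
    [LieGroup 𝓘(ℝ, V) ∞ N] [LieGroup 𝓘(ℝ, V') ∞ N']
    {θ : BilinField V' N'} (hθ : IsLeftInvariantSymplectic θ) (φ : N ≃* N')
    (hφ : ContMDiff 𝓘(ℝ, V) 𝓘(ℝ, V') ∞ φ) (hφ' : ContMDiff 𝓘(ℝ, V') 𝓘(ℝ, V) ∞ φ.symm) :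
    IsLeftInvariantSymplectic (BilinField.pullback (V := V) φ θ) where
  toIsSymplecticForm := hθ.toIsSymplecticForm.pullback
    (⟨φ.toEquiv, hφ, hφ'⟩ : N ≃ₘ^∞⟮𝓘(ℝ, V), 𝓘(ℝ, V')⟯ N')
  left_invariant g := by
    have hL : ContMDiff 𝓘(ℝ, V) 𝓘(ℝ, V) ∞ (fun x : N => g * x) := contMDiff_mul_left
    have hL' : ContMDiff 𝓘(ℝ, V') 𝓘(ℝ, V') ∞ (fun x : N' => φ g * x) := contMDiff_mul_left
    rw [← BilinField.pullback_comp θ hφ hL]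
    have hc : (φ : N → N') ∘ (fun x : N => g * x) = (fun x : N' => φ g * x) ∘ φ := by
      funext x; simp
    rw [hc, BilinField.pullback_comp θ hL' hφ, hθ.left_invariant]

theorem IsSymplecticIso.symm {θ : BilinField V N} {θ' : BilinField V' N'} {φ : N ≃* N'}
    (h : IsSymplecticIso θ θ' φ) : IsSymplecticIso θ' θ φ.symm where
  smooth := h.smooth_symm
  smooth_symm := h.smooth
  pullback_eq := by
    rw [← h.pullback_eq, ← BilinField.pullback_comp θ' h.smooth h.smooth_symm]
    have hc : (φ : N → N') ∘ φ.symm = fun x => x := by funext x; simp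
    rw [hc, BilinField.pullback_id]

theorem IsSymplecticIso.trans {θ : BilinField V N} {θ' : BilinField V' N'} {θ'' : BilinField W K}
    {φ : N ≃* N'} {ψ : N' ≃* K}
    (hφ : IsSymplecticIso θ θ' φ) (hψ : IsSymplecticIso θ' θ'' ψ) :
    IsSymplecticIso θ θ'' (φ.trans ψ) where
  smooth := hψ.smooth.comp hφ.smooth
  smooth_symm := hφ.smooth_symm.comp hψ.smooth_symm
  pullback_eq := by
    have h := BilinField.pullback_comp θ'' hψ.smooth hφ.smooth
    rw [hψ.pullback_eq, hφ.pullback_eq] at h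
    exact h

end PullbackGroups

/-! ### Transporting a Lie group structure along a homeomorphism -/

section Transport

variable {V : Type*} [NormedAddCommGroup V] [NormedSpace ℝ V]
  {N : Type*} [TopologicalSpace N]
  {G : Type*} [TopologicalSpace G] [ChartedSpace V G]

variable (V) in
/-- The charted space structure transported along a homeomorphism. -/
@[reducible]
def transportedCharts (h : N ≃ₜ G) : ChartedSpace V N where
  atlas := {c | ∃ c' ∈ atlas V G, c = h.toOpenPartialHomeomorph ≫ₕ c'}
  chartAt x := h.toOpenPartialHomeomorph ≫ₕ chartAt V (h x)
  mem_chart_source x := by simp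
  chart_mem_atlas x := ⟨_, chart_mem_atlas V (h x), rfl⟩

/-- In a change of transported charts `h` cancels, leaving a change of charts of `G`. -/
theorem isManifold_transportedCharts [IsManifold 𝓘(ℝ, V) ∞ G] (h : N ≃ₜ G) :
    letI := transportedCharts V h
    IsManifold 𝓘(ℝ, V) ∞ N := by
  let := transportedCharts V h
  have : HasGroupoid N (contDiffGroupoid ∞ 𝓘(ℝ, V)) := by
    refine ⟨?_⟩
    rintro _ _ ⟨c, hc, rfl⟩ ⟨c', hc', rfl⟩
    have hr : (h.toOpenPartialHomeomorph ≫ₕ c).symm ≫ₕ h.toOpenPartialHomeomorph ≫ₕ c' =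
        c.symm ≫ₕ c' := by
      rw [OpenPartialHomeomorph.trans_symm_eq_symm_trans_symm, OpenPartialHomeomorph.trans_assoc,
        ← OpenPartialHomeomorph.trans_assoc h.toOpenPartialHomeomorph.symm,
        ← Homeomorph.symm_toOpenPartialHomeomorph, ← Homeomorph.trans_toOpenPartialHomeomorph,
        Homeomorph.symm_trans_self, Homeomorph.refl_toOpenPartialHomeomorph,
        OpenPartialHomeomorph.refl_trans]
    rw [hr]
    exact HasGroupoid.compatible hc hc'
  exact IsManifold.mk' _ _ _

/-- Read in the transported chart, `h` has the same coordinate expression as the identity of `G`;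
the same holds for its inverse below. -/
theorem contMDiff_transportedCharts (h : N ≃ₜ G) :
    letI := transportedCharts V h
    ContMDiff 𝓘(ℝ, V) 𝓘(ℝ, V) ∞ h := by
  let := transportedCharts V h
  intro x
  have h1 := (contMDiffAt_iff (I := 𝓘(ℝ, V)) (I' := 𝓘(ℝ, V)) (n := ∞) (f := (id : G → G))
    (x := h x)).1 contMDiffAt_id
  refine contMDiffAt_iff.2 ⟨h.continuous.continuousAt, ?_⟩
  convert! h1.2 using 2
  funext y
  change h (h.symm ((chartAt V (h x)).symm y)) = _
  rw [h.apply_symm_apply]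
  rfl

theorem contMDiff_symm_transportedCharts (h : N ≃ₜ G) :
    letI := transportedCharts V h
    ContMDiff 𝓘(ℝ, V) 𝓘(ℝ, V) ∞ h.symm := by
  let := transportedCharts V h
  intro x
  have h1 := (contMDiffAt_iff (I := 𝓘(ℝ, V)) (I' := 𝓘(ℝ, V)) (n := ∞) (f := (id : G → G))
    (x := x)).1 contMDiffAt_id
  refine contMDiffAt_iff.2 ⟨h.symm.continuous.continuousAt, ?_⟩
  convert! h1.2 using 2
  funext y
  change chartAt V (h (h.symm x)) (h (h.symm ((chartAt V x).symm y))) = _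
  rw [h.apply_symm_apply, h.apply_symm_apply]
  rfl

theorem lieGroup_transportedCharts [Group G] [LieGroup 𝓘(ℝ, V) ∞ G] (h : N ≃ₜ G) :
    letI := transportedCharts V h
    letI := h.toEquiv.group
    LieGroup 𝓘(ℝ, V) ∞ N := by
  let := transportedCharts V h
  let := h.toEquiv.group
  have h1 := contMDiff_transportedCharts (V := V) h
  have h2 := contMDiff_symm_transportedCharts (V := V) h
  exact
    { isManifold_transportedCharts h with
      contMDiff_mul := h2.comp ((h1.comp contMDiff_fst).mul (h1.comp contMDiff_snd))
      contMDiff_inv := h2.comp h1.inv }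

end Transport

/-! ### Smooth trivializations and the embedding of the fibres -/

section Trivializations

variable {VG : Type*} [NormedAddCommGroup VG] [NormedSpace ℝ VG]
  {G : Type*} [TopologicalSpace G] [ChartedSpace VG G]
  {VM : Type*} [NormedAddCommGroup VM] [NormedSpace ℝ VM]
  {M : Type*} [TopologicalSpace M] [ChartedSpace VM M]
  {VE : Type*} [NormedAddCommGroup VE] [NormedSpace ℝ VE]
  {E : Type*} [TopologicalSpace E] [ChartedSpace VE E]
  {π : E → M} {e : Bundle.Trivialization G π}

theorem IsSmoothTriv.contMDiffAt (he : IsSmoothTriv VG VM VE e) {x : E} (hx : π x ∈ e.baseSet) :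
    ContMDiffAt 𝓘(ℝ, VE) (𝓘(ℝ, VM).prod 𝓘(ℝ, VG)) ∞ e x :=
  he.smooth.contMDiffAt (by
    rw [← e.source_eq]
    exact e.open_source.mem_nhds (e.mem_source.2 hx))

theorem IsSmoothTriv.contMDiffAt_symm (he : IsSmoothTriv VG VM VE e) {p : M}
    (hp : p ∈ e.baseSet) (g : G) :
    ContMDiffAt (𝓘(ℝ, VM).prod 𝓘(ℝ, VG)) 𝓘(ℝ, VE) ∞ e.toOpenPartialHomeomorph.symm (p, g) :=
  he.smooth_symm.contMDiffAt ((e.open_baseSet.prod isOpen_univ).mem_nhds ⟨hp, mem_univ _⟩)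

theorem IsSmoothTriv.mdifferentiable (he : IsSmoothTriv VG VM VE e) :
    e.toOpenPartialHomeomorph.MDifferentiable 𝓘(ℝ, VE) (𝓘(ℝ, VM).prod 𝓘(ℝ, VG)) := by
  refine ⟨?_, ?_⟩
  · rw [e.source_eq]
    exact he.smooth.mdifferentiableOn (by simp)
  · rw [e.target_eq]
    exact he.smooth_symm.mdifferentiableOn (by simp)

/-- The model space of `E` is not given as a product; the differential of a trivialization supplies
the identification. -/
theorem IsSmoothTriv.nonempty_modelEquiv [IsManifold 𝓘(ℝ, VM) ∞ M] [IsManifold 𝓘(ℝ, VG) ∞ G]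
    [IsManifold 𝓘(ℝ, VE) ∞ E] (he : IsSmoothTriv VG VM VE e) {x : E} (hx : π x ∈ e.baseSet) :
    Nonempty (VE ≃L[ℝ] VM × VG) := by
  exact ⟨he.mdifferentiable.mfderiv (e.mem_source.2 hx)⟩

/-- The chart of the total space of a fibre bundle given by a local trivialization, charts of the
base and of the fibre, and an identification of the model spaces. -/
def bundleChart (e : Bundle.Trivialization G π) (c : OpenPartialHomeomorph M VM)
    (d : OpenPartialHomeomorph G VG) (T : VM × VG ≃ₜ VE) : OpenPartialHomeomorph E VE :=
  (e.toOpenPartialHomeomorph ≫ₕ c.prod d) ≫ₕ T.toOpenPartialHomeomorph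

theorem bundleChart_mem_maximalAtlas [IsManifold 𝓘(ℝ, VM) ∞ M] [IsManifold 𝓘(ℝ, VG) ∞ G]
    [IsManifold 𝓘(ℝ, VE) ∞ E] (he : IsSmoothTriv VG VM VE e)
    {c : OpenPartialHomeomorph M VM} (hc : c ∈ atlas VM M)
    {d : OpenPartialHomeomorph G VG} (hd : d ∈ atlas VG G) {T : VM × VG ≃ₜ VE}
    (hT : ContDiff ℝ ∞ T) (hT' : ContDiff ℝ ∞ T.symm) :
    bundleChart e c d T ∈ IsManifold.maximalAtlas 𝓘(ℝ, VE) ∞ E := by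
  have hcd := IsManifold.mem_maximalAtlas_prod (n := ∞)
    (IsManifold.subset_maximalAtlas (I := 𝓘(ℝ, VM)) (n := ∞) hc)
    (IsManifold.subset_maximalAtlas (I := 𝓘(ℝ, VG)) (n := ∞) hd)
  have h1 := contMDiffOn_of_mem_maximalAtlas hcd
  have h2 := contMDiffOn_symm_of_mem_maximalAtlas hcd
  have hTm : ContMDiff (M := ModelProd VM VG) (𝓘(ℝ, VM).prod 𝓘(ℝ, VG)) 𝓘(ℝ, VE) ∞ T := by
    have h := hT.contMDiff
    rw [modelWithCornersSelf_prod] at h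
    exact h
  have hTm' : ContMDiff (M' := ModelProd VM VG) 𝓘(ℝ, VE) (𝓘(ℝ, VM).prod 𝓘(ℝ, VG)) ∞ T.symm := by
    have h := hT'.contMDiff
    rw [modelWithCornersSelf_prod] at h
    exact h
  refine (bundleChart e c d T).mem_maximalAtlas_of_contMDiffOn ?_ ?_
  · refine hTm.comp_contMDiffOn (h1.comp (he.smooth.mono ?_) ?_)
    · intro x hx
      exact e.mem_source.1 (show x ∈ e.source from hx.1.1)
    · intro x hx
      exact hx.1.2
  · refine (he.smooth_symm.comp (h2.comp hTm'.contMDiffOn ?_) ?_)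
    · intro x hx
      exact hx.2.1
    · intro x hx
      have h : (c.prod d).symm (T.symm x) ∈ e.target := hx.2.2
      rwa [e.target_eq] at h

/-- In a suitable bundle chart of `E` the inclusion of the fibre becomes the linear map `u ↦ L.symm
(0, u)`, the local normal form of an immersion. -/
theorem isSmoothEmbedding_fiber [IsManifold 𝓘(ℝ, VM) ∞ M] [IsManifold 𝓘(ℝ, VG) ∞ G]
    [IsManifold 𝓘(ℝ, VE) ∞ E] (he : IsSmoothTriv VG VM VE e) {p : M} (hp : p ∈ e.baseSet) :
    letI := transportedCharts VG (e.preimageSingletonHomeomorph hp)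
    IsSmoothEmbedding 𝓘(ℝ, VG) 𝓘(ℝ, VE) ∞ (Subtype.val : π ⁻¹' {p} → E) := by
  let := transportedCharts VG (e.preimageSingletonHomeomorph hp)
  have := isManifold_transportedCharts (V := VG) (e.preimageSingletonHomeomorph hp)
  refine ⟨IsImmersionOfComplement.isImmersion (F := VM) fun x => ?_,
    Topology.IsEmbedding.subtypeVal⟩
  have hx : π x ∈ e.baseSet := by
    rw [show π x = p from x.2]
    exact hp
  obtain ⟨L⟩ := he.nonempty_modelEquiv hx
  -- Translating by `-v` moves the base coordinate of `p` to `0`, so that the fibre over `p` lands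
  -- in a linear subspace rather than an affine one.
  let v : VE := L.symm (chartAt VM p p, 0)
  let T : VM × VG ≃ₜ VE := L.symm.toHomeomorph.trans (Homeomorph.addRight (-v))
  have hT : ∀ w, T w = L.symm w + -v := fun _ => rfl
  have hT' : ∀ w, T.symm w = L (w + v) := fun w => by
    rw [Homeomorph.symm_apply_eq, hT]
    simp
  have hTs : ContDiff ℝ ∞ T := L.symm.contDiff.add contDiff_const
  have hTs' : ContDiff ℝ ∞ T.symm := by
    rw [show (T.symm : VE → VM × VG) = fun w => L (w + v) from funext hT']
    exact L.contDiff.comp (contDiff_id.add contDiff_const)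
  let g := e.preimageSingletonHomeomorph hp x
  have hmap : ∀ y : π ⁻¹' {p}, e (y : E) = (p, e.preimageSingletonHomeomorph hp y) := fun y =>
    Prod.ext ((e.coe_fst' (by rw [show π y = p from y.2]; exact hp)).trans y.2) rfl
  have hsrc : (chartAt VG x).source ⊆
      (Subtype.val : π ⁻¹' {p} → E) ⁻¹' (bundleChart e (chartAt VM p) (chartAt VG g) T).source := by
    intro y hy
    refine ⟨⟨e.mem_source.2 (by rw [show π y = p from y.2]; exact hp), ?_⟩, mem_univ _⟩
    change e (y : E) ∈ ((chartAt VM p).prod (chartAt VG g)).source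
    rw [hmap]
    exact ⟨mem_chart_source _ _, hy.2⟩
  refine IsImmersionAtOfComplement.mk_of_charts
    ((ContinuousLinearEquiv.prodComm ℝ VG VM).trans L.symm)
    (chartAt VG x) (bundleChart e (chartAt VM p) (chartAt VG g) T)
    (mem_chart_source _ _) (hsrc (mem_chart_source _ _)) (IsManifold.chart_mem_maximalAtlas x)
    (bundleChart_mem_maximalAtlas he (chart_mem_atlas _ _) (chart_mem_atlas _ _) hTs hTs') hsrc ?_
  intro u hu
  have hu' : u ∈ (chartAt VG g).target := by
    have hu2 : u ∈ (chartAt VG x).target := by simpa using hu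
    exact hu2.1
  change T ((chartAt VM p).prod (chartAt VG g)
    (e ((e.preimageSingletonHomeomorph hp).symm ((chartAt VG g).symm u) : E))) = L.symm (0, u)
  rw [hmap, Homeomorph.apply_symm_apply, hT]
  change L.symm (chartAt VM p p, (chartAt VG g) ((chartAt VG g).symm u)) + -v = _
  rw [(chartAt VG g).right_inv hu', ← sub_eq_add_neg, ← map_sub]
  simp

end Trivializations

/-! ### The vertical form of a trivialization and its invariance -/

section VerticalForms

variable {VG : Type*} [NormedAddCommGroup VG] [NormedSpace ℝ VG]
  {G : Type*} [TopologicalSpace G] [ChartedSpace VG G]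
  {VM : Type*} [NormedAddCommGroup VM] [NormedSpace ℝ VM]
  {M : Type*} [TopologicalSpace M] [ChartedSpace VM M]
  {VE : Type*} [NormedAddCommGroup VE] [NormedSpace ℝ VE]
  {E : Type*} [TopologicalSpace E] [ChartedSpace VE E]
  {π : E → M} {e e' : Bundle.Trivialization G π}

/-- The fibre component `π⁻¹(U) → G` of a local trivialization. -/
def fiberCoord (e : Bundle.Trivialization G π) (x : E) : G := (e x).2

theorem IsSmoothTriv.contMDiffAt_fiberCoord (he : IsSmoothTriv VG VM VE e) {x : E}
    (hx : π x ∈ e.baseSet) : ContMDiffAt 𝓘(ℝ, VE) 𝓘(ℝ, VG) ∞ (fiberCoord e) x :=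
  contMDiffAt_snd.comp x (he.contMDiffAt hx)

variable (VM VE) in
/-- The form on the vertical bundle induced by a field of bilinear forms on the fibre through a
local trivialization. -/
def verticalForm (θ : BilinField VG G) (e : Bundle.Trivialization G π) (x : E) :
    LinearMap.BilinForm ℝ (Vertical VM VE π x) :=
  (BilinField.pullback (V := VE) (fiberCoord e) θ x).compl₁₂
    (Vertical VM VE π x).subtype (Vertical VM VE π x).subtype

theorem verticalForm_apply (θ : BilinField VG G) (e : Bundle.Trivialization G π) (x : E)
    (u v : Vertical VM VE π x) :
    verticalForm VM VE θ e x u v = θ (fiberCoord e x)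
      (mfderiv 𝓘(ℝ, VE) 𝓘(ℝ, VG) (fiberCoord e) x (u : TangentSpace 𝓘(ℝ, VE) x))
      (mfderiv 𝓘(ℝ, VE) 𝓘(ℝ, VG) (fiberCoord e) x (v : TangentSpace 𝓘(ℝ, VE) x)) := rfl

/-- The restriction of the form induced by a local trivialization to a fibre is the pullback of
the form on the model fibre. -/
theorem restrictToFiber_eq_pullback (hπ : ContMDiff 𝓘(ℝ, VE) 𝓘(ℝ, VM) ∞ π)
    {σ : ∀ x : E, LinearMap.BilinForm ℝ (Vertical VM VE π x)} {p : M}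
    [ChartedSpace VG (π ⁻¹' {p})]
    (hι : ContMDiff 𝓘(ℝ, VG) 𝓘(ℝ, VE) ∞ (Subtype.val : π ⁻¹' {p} → E))
    (he : IsSmoothTriv VG VM VE e) (hp : p ∈ e.baseSet) {θ : BilinField VG G}
    (hσ : ∀ x : E, π x = p → σ x = verticalForm VM VE θ e x) :
    restrictToFiber hπ σ p hι =
      BilinField.pullback (V := VG) (fun x : π ⁻¹' {p} => fiberCoord e x) θ := by
  funext x
  refine LinearMap.ext₂ fun u v => ?_
  have hx : π x ∈ e.baseSet := by
    rw [show π x = p from x.2]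
    exact hp
  have h := mfderiv_comp x ((he.contMDiffAt_fiberCoord hx).mdifferentiableAt (by simp))
    (hι.mdifferentiable (by simp) x)
  change σ x (fiberInclusion hπ p hι x u) (fiberInclusion hπ p hι x v) = _
  rw [hσ x x.2, verticalForm_apply, BilinField.pullback_apply]
  change _ = θ (fiberCoord e x) (mfderiv 𝓘(ℝ, VG) 𝓘(ℝ, VG) (fiberCoord e ∘ Subtype.val) x u)
    (mfderiv 𝓘(ℝ, VG) 𝓘(ℝ, VG) (fiberCoord e ∘ Subtype.val) x v)
  rw [h]
  rfl

theorem IsSmoothTriv.mfderiv_apply (hπ : ContMDiff 𝓘(ℝ, VE) 𝓘(ℝ, VM) ∞ π)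
    (he : IsSmoothTriv VG VM VE e) {x : E} (hx : π x ∈ e.baseSet)
    (u : TangentSpace 𝓘(ℝ, VE) x) :
    mfderiv 𝓘(ℝ, VE) (𝓘(ℝ, VM).prod 𝓘(ℝ, VG)) e x u =
      (mfderiv 𝓘(ℝ, VE) 𝓘(ℝ, VM) π x u, mfderiv 𝓘(ℝ, VE) 𝓘(ℝ, VG) (fiberCoord e) x u) := by
  have hev : e =ᶠ[nhds x] fun y => (π y, fiberCoord e y) := by
    filter_upwards [e.open_source.mem_nhds (e.mem_source.2 hx)] with y hy
    exact Prod.ext (e.coe_fst hy) rfl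
  rw [hev.mfderiv_eq, mfderiv_prodMk (hπ.mdifferentiable (by simp) x)
    ((he.contMDiffAt_fiberCoord hx).mdifferentiableAt (by simp))]
  rfl

/-- The change of trivialization, `(p, g) ↦ φ(p) g`. -/
def transitionMap (e e' : Bundle.Trivialization G π) (q : M × G) : G :=
  fiberCoord e' (e.toOpenPartialHomeomorph.symm q)

theorem transitionMap_fiberCoord {e e' : Bundle.Trivialization G π} {x : E}
    (hx : π x ∈ e.baseSet) : transitionMap e e' (π x, fiberCoord e x) = fiberCoord e' x := by
  rw [show (π x, fiberCoord e x) = e x from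
    (Prod.ext (e.coe_fst' hx) rfl : e x = (π x, fiberCoord e x)).symm]
  exact congrArg _ (e.left_inv (e.mem_source.2 hx))

theorem contMDiffAt_transitionMap (he : IsSmoothTriv VG VM VE e) (he' : IsSmoothTriv VG VM VE e')
    {p : M} (hp : p ∈ e.baseSet) (hp' : p ∈ e'.baseSet) (g : G) :
    ContMDiffAt (𝓘(ℝ, VM).prod 𝓘(ℝ, VG)) 𝓘(ℝ, VG) ∞ (transitionMap e e') (p, g) := by
  refine ContMDiffAt.comp (p, g) (he'.contMDiffAt_fiberCoord ?_) (he.contMDiffAt_symm hp g)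
  rw [e.proj_symm_apply' hp]
  exact hp'

/-- On vertical vectors, the fibre components of two trivializations are related by the
differential of the transition map at the given base point. -/
theorem mfderiv_fiberCoord_of_vertical (hπ : ContMDiff 𝓘(ℝ, VE) 𝓘(ℝ, VM) ∞ π)
    (he : IsSmoothTriv VG VM VE e) (he' : IsSmoothTriv VG VM VE e') {x : E}
    (hx : π x ∈ e.baseSet) (hx' : π x ∈ e'.baseSet) (u : Vertical VM VE π x) :
    mfderiv 𝓘(ℝ, VE) 𝓘(ℝ, VG) (fiberCoord e') x (u : TangentSpace 𝓘(ℝ, VE) x) =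
      mfderiv 𝓘(ℝ, VG) 𝓘(ℝ, VG) (fun g => transitionMap e e' (π x, g)) (fiberCoord e x)
        (mfderiv 𝓘(ℝ, VE) 𝓘(ℝ, VG) (fiberCoord e) x (u : TangentSpace 𝓘(ℝ, VE) x)) := by
  have hex : e x = (π x, fiberCoord e x) := Prod.ext (e.coe_fst' hx) rfl
  have hF := (contMDiffAt_transitionMap he he' hx hx' (fiberCoord e x)).mdifferentiableAt
    (by simp)
  have hev : fiberCoord e' =ᶠ[nhds x] transitionMap e e' ∘ e := by
    filter_upwards [e.open_source.mem_nhds (e.mem_source.2 hx)] with y hy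
    have : e.toOpenPartialHomeomorph.symm (e y) = y := e.left_inv hy
    simp [transitionMap, this]
  -- Verticality kills the base component, so only the partial derivative of the transition map
  -- along `G` survives.
  have hu : mfderiv 𝓘(ℝ, VE) 𝓘(ℝ, VM) π x (u : TangentSpace 𝓘(ℝ, VE) x) = 0 := u.2
  have h1 := hev.mfderiv_eq (I := 𝓘(ℝ, VE)) (I' := 𝓘(ℝ, VG))
  have h2 := mfderiv_comp_apply x (by rw [hex]; exact hF)
    ((he.contMDiffAt hx).mdifferentiableAt (by simp)) (u : TangentSpace 𝓘(ℝ, VE) x)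
  have h3 := he.mfderiv_apply hπ hx (u : TangentSpace 𝓘(ℝ, VE) x)
  have h4 := mfderiv_comp_apply (fiberCoord e x) (f := fun g => (π x, g)) hF
    (contMDiffAt_const.prodMk contMDiffAt_id |>.mdifferentiableAt (n := ∞) (by simp))
    (mfderiv 𝓘(ℝ, VE) 𝓘(ℝ, VG) (fiberCoord e) x (u : TangentSpace 𝓘(ℝ, VE) x))
  rw [hu] at h3
  rw [mfderiv_prod_right] at h4
  rw [h3] at h2
  rw! [hex] at h2
  exact (congrArg (fun T : VE →L[ℝ] VG => T (u : TangentSpace 𝓘(ℝ, VE) x)) h1).trans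
    (h2.trans h4.symm)

/-- The gluing step: vertical vectors see the change of trivialization only through the differential
of `τ`, and `τ` preserves `θ`. Only the value of the transition function at `π x` matters. -/
theorem verticalForm_congr [Group G] (hπ : ContMDiff 𝓘(ℝ, VE) 𝓘(ℝ, VM) ∞ π)
    (he : IsSmoothTriv VG VM VE e) (he' : IsSmoothTriv VG VM VE e') {θ : BilinField VG G} {x : E}
    (hx : π x ∈ e.baseSet) (hx' : π x ∈ e'.baseSet) {τ : MulAut G} (hτ : τ ∈ symplecticAut θ)
    (hτe : ∀ g, transitionMap e e' (π x, g) = τ g) :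
    verticalForm VM VE θ e' x = verticalForm VM VE θ e x := by
  refine LinearMap.ext₂ fun u v => ?_
  have hfun : (fun g => transitionMap e e' (π x, g)) = τ := funext hτe
  have hval : fiberCoord e' x = τ (fiberCoord e x) := by
    rw [← hτe, transitionMap_fiberCoord hx]
  have hpb := congrFun (IsSymplecticIso.pullback_eq hτ) (fiberCoord e x)
  rw [verticalForm_apply, verticalForm_apply, mfderiv_fiberCoord_of_vertical hπ he he' hx hx' u,
    mfderiv_fiberCoord_of_vertical hπ he he' hx hx' v, hfun, ← hpb, BilinField.pullback_apply]
  rw! [hval]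
  rfl

theorem verticalForm_alt {θ : BilinField VG G} (hθ : ∀ g, (θ g).IsAlt) (x : E) :
    (verticalForm VM VE θ e x).IsAlt := fun _ => hθ _ _

end VerticalForms

/-! ### Smoothness through the Maurer-Cartan form -/

section Smoothness

variable {VG : Type*} [NormedAddCommGroup VG] [NormedSpace ℝ VG]
  {G : Type*} [TopologicalSpace G] [ChartedSpace VG G] [Group G] [LieGroup 𝓘(ℝ, VG) ∞ G]
  {VE : Type*} [NormedAddCommGroup VE] [NormedSpace ℝ VE]
  {E : Type*} [TopologicalSpace E] [ChartedSpace VE E]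

/-- Two points are allowed because it is applied to `(f x)⁻¹ * f x` and `(f x₀)⁻¹ * f x₀`, which are
equal without being the same term. -/
theorem trivializationAt_apply_snd {g g₀ : G} (h : g = g₀) (v : VG) :
    (trivializationAt VG (TangentSpace 𝓘(ℝ, VG)) g₀ (⟨g, v⟩ : TangentBundle 𝓘(ℝ, VG) G)).2 = v := by
  subst h
  exact (tangentBundleCore 𝓘(ℝ, VG) G).coordChange_self (achart VG g) g (mem_chart_source _ _) v

/-- The Maurer-Cartan form of `G`, pulled back along `f : E → G`, evaluated on the field `X`. -/
def maurerCartanPullback (f : E → G) (X : ∀ x : E, TangentSpace 𝓘(ℝ, VE) x) (x : E) : VG :=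
  mfderiv 𝓘(ℝ, VE) 𝓘(ℝ, VG) (fun y => (f x)⁻¹ * f y) x (X x)

/-- It is the partial derivative in `y`, on the diagonal, of the jointly smooth map `(x, y) ↦ (f
x)⁻¹ * f y`. On the diagonal this map is constantly `1`, so the tangent coordinates at the target
are trivial. -/
theorem contMDiffAt_maurerCartanPullback [IsManifold 𝓘(ℝ, VE) ∞ E] {f : E → G} {x₀ : E}
    (hf : ContMDiffAt 𝓘(ℝ, VE) 𝓘(ℝ, VG) ∞ f x₀) {X : ∀ x : E, TangentSpace 𝓘(ℝ, VE) x}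
    (hX : ContMDiffAt 𝓘(ℝ, VE) 𝓘(ℝ, VE).tangent ∞
      (fun x => (⟨x, X x⟩ : TangentBundle 𝓘(ℝ, VE) E)) x₀) :
    ContMDiffAt 𝓘(ℝ, VE) 𝓘(ℝ, VG) ∞ (maurerCartanPullback (VG := VG) f X) x₀ := by
  have h1 : ContMDiffAt (𝓘(ℝ, VE).prod 𝓘(ℝ, VE)) 𝓘(ℝ, VG) ∞
      (Function.uncurry fun x y => (f x)⁻¹ * f y) (x₀, id x₀) :=
    ContMDiffAt.mul (ContMDiffAt.inv (hf.comp (x₀, x₀) contMDiffAt_fst))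
      (hf.comp (x₀, x₀) contMDiffAt_snd)
  have h2 := ContMDiffAt.mfderiv (m := ∞) (fun x y => (f x)⁻¹ * f y) id h1 contMDiffAt_id
    (by simp)
  have h3 := ContMDiffAt.clm_apply_of_inCoordinates (b₁ := fun x : E => x)
    (b₂ := fun x : E => (f x)⁻¹ * f x) (v := X) h2 hX (hf.inv.mul hf)
  refine (Bundle.contMDiffAt_totalSpace.1 h3).2.congr_of_eventuallyEq
    (Filter.Eventually.of_forall fun x => ?_)
  exact (trivializationAt_apply_snd (by simp) _).symm

/-- The image of `X` under `f` is only a field along `f`, so smoothness of `θ` on vector fields of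
`G` does not apply directly. Left invariance instead moves everything to the identity, where `θ` is
one fixed bilinear form evaluated on Maurer-Cartan pullbacks. -/
theorem contMDiffAt_pullback_apply [FiniteDimensional ℝ VG] [IsManifold 𝓘(ℝ, VE) ∞ E] {θ : BilinField VG G}
    (hθ : ∀ g : G, BilinField.pullback (fun x : G => g * x) θ = θ) {f : E → G} {x₀ : E}
    (hf : ContMDiffAt 𝓘(ℝ, VE) 𝓘(ℝ, VG) ∞ f x₀) {X Y : ∀ x : E, TangentSpace 𝓘(ℝ, VE) x}
    (hX : ContMDiffAt 𝓘(ℝ, VE) 𝓘(ℝ, VE).tangent ∞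
      (fun x => (⟨x, X x⟩ : TangentBundle 𝓘(ℝ, VE) E)) x₀)
    (hY : ContMDiffAt 𝓘(ℝ, VE) 𝓘(ℝ, VE).tangent ∞
      (fun x => (⟨x, Y x⟩ : TangentBundle 𝓘(ℝ, VE) E)) x₀) :
    ContMDiffAt 𝓘(ℝ, VE) 𝓘(ℝ, ℝ) ∞
      (fun x => BilinField.pullback (V := VE) f θ x (X x) (Y x)) x₀ := by
  let B : VG →L[ℝ] VG →L[ℝ] ℝ := LinearMap.toContinuousLinearMap
    ((LinearMap.toContinuousLinearMap : (VG →ₗ[ℝ] ℝ) ≃ₗ[ℝ] (VG →L[ℝ] ℝ)).toLinearMap ∘ₗ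
      (show VG →ₗ[ℝ] VG →ₗ[ℝ] ℝ from θ (1 : G)))
  have hB : ContMDiffAt 𝓘(ℝ, VE) 𝓘(ℝ, ℝ) ∞ (fun x => B (maurerCartanPullback (VG := VG) f X x)
      (maurerCartanPullback (VG := VG) f Y x)) x₀ :=
    (B.contMDiff.contMDiffAt.comp x₀ (contMDiffAt_maurerCartanPullback hf hX)).clm_apply
      (contMDiffAt_maurerCartanPullback hf hY)
  refine hB.congr_of_eventuallyEq ?_
  -- The chain rule is needed at all nearby points; regularity of a finite order at `x₀` spreads to
  -- a neighbourhood, and order `1` suffices.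
  filter_upwards [(contMDiffAt_iff_contMDiffAt_nhds (n := 1) (by simp)).1
    (hf.of_le (by simp))] with x hx
  have hL : ContMDiff 𝓘(ℝ, VG) 𝓘(ℝ, VG) ∞ (fun y : G => (f x)⁻¹ * y) := contMDiff_mul_left
  have hd := mfderiv_comp x (hL.mdifferentiable (by simp) (f x))
    (hx.mdifferentiableAt one_ne_zero)
  have h1 : ∀ (g : G) (u v : VG), g = 1 → θ g u v = θ 1 u v := by
    rintro g u v rfl
    rfl
  have h2 : BilinField.pullback (V := VE) f θ x (X x) (Y x) =
      BilinField.pullback (V := VE) f (BilinField.pullback (V := VG) (fun y : G => (f x)⁻¹ * y) θ) x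
        (X x) (Y x) := by
    rw [hθ]
  rw [h2]
  refine Eq.trans ?_ (h1 ((f x)⁻¹ * f x) _ _ (by simp))
  change _ = θ ((f x)⁻¹ * f x) (mfderiv 𝓘(ℝ, VE) 𝓘(ℝ, VG) ((fun y : G => (f x)⁻¹ * y) ∘ f) x (X x))
    (mfderiv 𝓘(ℝ, VE) 𝓘(ℝ, VG) ((fun y : G => (f x)⁻¹ * y) ∘ f) x (Y x))
  rw [hd]
  rfl

end Smoothness

/-! ### From transition functions to the bundle structure -/

section Construction

variable {VG : Type*} [NormedAddCommGroup VG] [NormedSpace ℝ VG]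
  {G : Type*} [TopologicalSpace G] [ChartedSpace VG G] [Group G]
  {VM : Type*} [NormedAddCommGroup VM] [NormedSpace ℝ VM]
  {M : Type*} [TopologicalSpace M] [ChartedSpace VM M]
  {VE : Type*} [NormedAddCommGroup VE] [NormedSpace ℝ VE]
  {E : Type*} [TopologicalSpace E] [ChartedSpace VE E]
  {π : E → M}

/-- The isomorphism of a fibre with `G` given by a local trivialization, for the group structure
on the fibre transported from `G`. -/
def fiberMulEquiv (e : Bundle.Trivialization G π) {p : M} (hp : p ∈ e.baseSet) :
    letI := (e.preimageSingletonHomeomorph hp).toEquiv.group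
    (π ⁻¹' {p}) ≃* G :=
  letI := (e.preimageSingletonHomeomorph hp).toEquiv.group
  { (e.preimageSingletonHomeomorph hp).toEquiv with
    map_mul' := fun _ _ => (e.preimageSingletonHomeomorph hp).apply_symm_apply _ }

theorem IsTransitionFunction.transitionMap_eq {e e' : Bundle.Trivialization G π}
    {K : Subgroup (MulAut G)} {τ : (e.baseSet ∩ e'.baseSet : Set M) → K}
    (hτ : IsTransitionFunction e e' τ) {p : M} (hp : p ∈ e.baseSet ∩ e'.baseSet) (g : G) :
    transitionMap e e' (p, g) = (τ ⟨p, hp⟩ : MulAut G) g :=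
  congrArg Prod.snd (hτ ⟨p, hp⟩ g)

theorem exists_symplecticAut_transitionMap {θ : BilinField VG G}
    {A : Set (Bundle.Trivialization G π)}
    (hA : ∀ e ∈ A, ∀ e' ∈ A, ∃ τ : (e.baseSet ∩ e'.baseSet : Set M) → symplecticAut θ,
      IsTransitionFunction e e' τ) {e e' : Bundle.Trivialization G π} (he : e ∈ A) (he' : e' ∈ A)
    {p : M} (hp : p ∈ e.baseSet) (hp' : p ∈ e'.baseSet) :
    ∃ τ ∈ symplecticAut θ, ∀ g, transitionMap e e' (p, g) = τ g := by
  obtain ⟨τ, hτ⟩ := hA e he e' he'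
  exact ⟨τ ⟨p, hp, hp'⟩, (τ ⟨p, hp, hp'⟩).2, fun g => hτ.transitionMap_eq ⟨hp, hp'⟩ g⟩

variable [FiniteDimensional ℝ VG] [LieGroup 𝓘(ℝ, VG) ∞ G] [IsManifold 𝓘(ℝ, VE) ∞ E]

/-- Both conditions are local, so one trivialization around each point is enough. -/
theorem isVerticalTwoForm_of_trivializations {θ : BilinField VG G} (hθ : IsLeftInvariantSymplectic θ)
    {σ : ∀ x : E, LinearMap.BilinForm ℝ (Vertical VM VE π x)}
    (hσ : ∀ x₀ : E, ∃ e : Bundle.Trivialization G π, IsSmoothTriv VG VM VE e ∧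
      π x₀ ∈ e.baseSet ∧ ∀ x, π x ∈ e.baseSet → σ x = verticalForm VM VE θ e x) :
    IsVerticalTwoForm σ where
  alt x := by
    obtain ⟨e, -, hx, h⟩ := hσ x
    rw [h x hx]
    exact verticalForm_alt hθ.alt x
  smooth U hU X Y hX hY x₀ hx₀ := by
    obtain ⟨e, he, hx, h⟩ := hσ x₀
    have hU' := hU.mem_nhds hx₀
    refine ((contMDiffAt_pullback_apply hθ.left_invariant (he.contMDiffAt_fiberCoord hx)
      (hX.contMDiffAt hU') (hY.contMDiffAt hU')).congr_of_eventuallyEq ?_).contMDiffWithinAt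
    filter_upwards [e.open_source.mem_nhds (e.mem_source.2 hx)] with x hxe
    rw [h x (e.mem_source.1 hxe)]
    rfl

variable [IsManifold 𝓘(ℝ, VM) ∞ M]

/-- The symplectic Lie group bundle structure defined by a system of local trivializations with
transition functions in `Aut(G, θ)`. -/
def SLGBStructure.ofTrivSystem {θ : BilinField VG G} (hθ : IsLeftInvariantSymplectic θ)
    (hπ : IsSmoothFiberBundle VG G VM VE π) {A : Set (Bundle.Trivialization G π)}
    (hA : IsTrivSystem VG VM VE A)
    (hτ : ∀ e ∈ A, ∀ e' ∈ A, ∃ τ : (e.baseSet ∩ e'.baseSet : Set M) → symplecticAut θ,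
      IsTransitionFunction e e' τ) : SLGBStructure θ π hπ :=
  -- An arbitrary choice over each base point, with no regularity in `p`; `hform` shows that the
  -- form does not depend on it.
  let t : M → Bundle.Trivialization G π := fun p => (hA.cover p).choose
  have htA : ∀ p, t p ∈ A := fun p => (hA.cover p).choose_spec.1
  have htp : ∀ p, p ∈ (t p).baseSet := fun p => (hA.cover p).choose_spec.2
  let form : ∀ x : E, LinearMap.BilinForm ℝ (Vertical VM VE π x) :=
    fun x => verticalForm VM VE θ (t (π x)) x
  have hform : ∀ e ∈ A, ∀ x, π x ∈ e.baseSet → form x = verticalForm VM VE θ e x := by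
    intro e he x hx
    obtain ⟨τ, hτA, hτe⟩ := exists_symplecticAut_transitionMap hτ he (htA (π x)) hx (htp (π x))
    exact verticalForm_congr hπ.smooth (hA.smooth e he) (hA.smooth _ (htA (π x))) hx
      (htp (π x)) hτA hτe
  have hiso : ∀ p : M,
      letI := ((t p).preimageSingletonHomeomorph (htp p)).toEquiv.group
      letI := transportedCharts VG ((t p).preimageSingletonHomeomorph (htp p))
      IsSymplecticIso (restrictToFiber hπ.smooth form p
        (isSmoothEmbedding_fiber (hA.smooth _ (htA p)) (htp p)).contMDiff) θ
        (fiberMulEquiv (t p) (htp p)) := by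
    intro p
    let := ((t p).preimageSingletonHomeomorph (htp p)).toEquiv.group
    let := transportedCharts VG ((t p).preimageSingletonHomeomorph (htp p))
    exact
      { smooth := contMDiff_transportedCharts _
        smooth_symm := contMDiff_symm_transportedCharts _
        pullback_eq := (restrictToFiber_eq_pullback hπ.smooth
          (isSmoothEmbedding_fiber (hA.smooth _ (htA p)) (htp p)).contMDiff
          (hA.smooth _ (htA p)) (htp p) (fun x hx => by subst hx; rfl)).symm }
  { fiberGroup := fun p => ((t p).preimageSingletonHomeomorph (htp p)).toEquiv.group
    fiberCharts := fun p => transportedCharts VG ((t p).preimageSingletonHomeomorph (htp p))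
    fiber_lieGroup := fun p => lieGroup_transportedCharts _
    fiber_embedded := fun p => isSmoothEmbedding_fiber (hA.smooth _ (htA p)) (htp p)
    form := form
    form_smooth := isVerticalTwoForm_of_trivializations hθ fun x => ⟨t (π x), hA.smooth _ (htA _),
      htp _, hform _ (htA _)⟩
    fiber_symplectic := fun p => by
      let := ((t p).preimageSingletonHomeomorph (htp p)).toEquiv.group
      let := transportedCharts VG ((t p).preimageSingletonHomeomorph (htp p))
      have : LieGroup 𝓘(ℝ, VG) ∞ (π ⁻¹' {p}) := lieGroup_transportedCharts _
      have := FiniteDimensional.complete ℝ VG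
      rw [← (hiso p).pullback_eq]
      exact hθ.pullback _ (hiso p).smooth (hiso p).smooth_symm
    exists_triv := by
      refine ⟨A, hA, fun e he p hp => ?_⟩
      obtain ⟨τ, hτA, hτe⟩ := exists_symplecticAut_transitionMap hτ (htA p) he (htp p) hp
      let := ((t p).preimageSingletonHomeomorph (htp p)).toEquiv.group
      let := transportedCharts VG ((t p).preimageSingletonHomeomorph (htp p))
      -- The group on the fibre comes from `t p`; any other trivialization of `A` differs from it by
      -- the automorphism `τ`, so it is an isomorphism too.
      refine ⟨(fiberMulEquiv (t p) (htp p)).trans τ, fun x => ?_, (hiso p).trans hτA⟩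
      have hx : π x = p := x.2
      refine (hτe _).symm.trans ?_
      have h := transitionMap_fiberCoord (e := t p) (e' := e) (x := (x : E)) (by rw [hx]; exact htp p)
      rw [hx] at h
      exact h }

end Construction

/-! ### From the bundle structure to smooth transition functions -/

section SmoothTransition

variable {VG : Type*} [NormedAddCommGroup VG] [NormedSpace ℝ VG]
  {G : Type*} [TopologicalSpace G] [ChartedSpace VG G] [Group G]
  {VM : Type*} [NormedAddCommGroup VM] [NormedSpace ℝ VM]
  {M : Type*} [TopologicalSpace M] [ChartedSpace VM M]
  {VE : Type*} [NormedAddCommGroup VE] [NormedSpace ℝ VE]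
  {E : Type*} [TopologicalSpace E] [ChartedSpace VE E]
  {π : E → M}

/-- Transition functions of smooth trivializations with values in `Aut(G, θ)` are smooth as maps
into `Aut(G, θ)`. -/
theorem IsTransitionFunction.isSmoothIntoAut [IsManifold 𝓘(ℝ, VG) ∞ G]
    [IsManifold 𝓘(ℝ, VM) ∞ M] {θ : BilinField VG G}
    {e e' : Bundle.Trivialization G π} (he : IsSmoothTriv VG VM VE e)
    (he' : IsSmoothTriv VG VM VE e') {τ : (e.baseSet ∩ e'.baseSet : Set M) → symplecticAut θ}
    (hτ : IsTransitionFunction e e' τ) :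
    IsSmoothIntoAut (VM := VM) _ (e.open_baseSet.inter e'.open_baseSet) τ := by
  intro p₀
  let W : TopologicalSpace.Opens M := ⟨_, e.open_baseSet.inter e'.open_baseSet⟩
  let f : W → G → G := fun p g => transitionMap e e' ((p : M), g)
  have hf : ∀ p : W, f p = (τ p : MulAut G) := fun p =>
    funext fun g => hτ.transitionMap_eq p.2 g
  have h1 : ContMDiffAt (𝓘(ℝ, VM).prod 𝓘(ℝ, VG)) 𝓘(ℝ, VG) ∞ (Function.uncurry f) (p₀, 1) :=
    (contMDiffAt_transitionMap he he' p₀.2.1 p₀.2.2 1).comp (p₀, (1 : G))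
      ((contMDiff_subtype_val.contMDiffAt.comp _ contMDiffAt_fst).prodMk contMDiffAt_snd)
  -- Smooth dependence on `p` of the derivative along `G` at `1`, in tangent coordinates. As every
  -- `f p` fixes `1`, the coordinate changes at source and target are the identity, which leaves
  -- `lieAlgebraMap`.
  have h2 := ContMDiffAt.mfderiv (m := ∞) f (fun _ => (1 : G)) h1 contMDiffAt_const (by simp)
  refine h2.congr_of_eventuallyEq (Filter.Eventually.of_forall fun p => ?_)
  have hone : ∀ p : W, f p 1 = 1 := fun p => by
    rw [hf]
    exact map_one _
  have hc : ∀ {g g₀ : G} (v : VG), g = g₀ →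
      (tangentBundleCore 𝓘(ℝ, VG) G).coordChange (achart VG g) (achart VG g₀) g v = v := by
    rintro g _ v rfl
    exact (tangentBundleCore 𝓘(ℝ, VG) G).coordChange_self (achart VG g) g (mem_chart_source _ _) v
  refine Eq.trans ?_ (inTangentCoordinates_eq (I := 𝓘(ℝ, VG)) (I' := 𝓘(ℝ, VG)) (fun _ : W => (1 : G))
    (fun p => f p 1) (fun p => mfderiv 𝓘(ℝ, VG) 𝓘(ℝ, VG) (f p) (1 : G)) (x₀ := p₀) (x := p)
    (mem_chart_source _ _) (by rw [hone p, hone p₀]; exact mem_chart_source _ _)).symm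
  ext v
  refine Eq.trans ?_ (hc _ ((hone p).trans (hone p₀).symm)).symm
  refine Eq.trans ?_ (congrArg (fun w : VG => (mfderiv 𝓘(ℝ, VG) 𝓘(ℝ, VG) (f p) (1 : G) : VG →L[ℝ] VG) w)
    (hc v rfl).symm)
  rw [hf]
  rfl

/-- The trivializations of a symplectic Lie group bundle have transition functions in
`Aut(G, θ)`. -/
theorem exists_isTransitionFunction [IsManifold 𝓘(ℝ, VE) ∞ E] {θ : BilinField VG G}
    {hπ : IsSmoothFiberBundle VG G VM VE π} (S : SLGBStructure θ π hπ)
    {A : Set (Bundle.Trivialization G π)}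
    (hA : ∀ e ∈ A, ∀ p ∈ e.baseSet,
      letI := S.fiberGroup p
      letI := S.fiberCharts p
      ∃ φ : (π ⁻¹' {p}) ≃* G, (∀ x : π ⁻¹' {p}, φ x = (e (x : E)).2) ∧
        IsSymplecticIso (restrictToFiber hπ.smooth S.form p (S.fiber_embedded p).contMDiff) θ φ)
    {e e' : Bundle.Trivialization G π} (he : e ∈ A) (he' : e' ∈ A) :
    ∃ τ : (e.baseSet ∩ e'.baseSet : Set M) → symplecticAut θ, IsTransitionFunction e e' τ := by
  have key : ∀ p : (e.baseSet ∩ e'.baseSet : Set M), ∃ τ : symplecticAut θ, ∀ g : G,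
      e' (e.toOpenPartialHomeomorph.symm ((p : M), g)) = ((p : M), (τ : MulAut G) g) := by
    intro p
    let := S.fiberGroup p
    let := S.fiberCharts p
    obtain ⟨φ, hφ, hφs⟩ := hA e he p p.2.1
    obtain ⟨φ', hφ', hφs'⟩ := hA e' he' p p.2.2
    refine ⟨⟨φ.symm.trans φ', hφs.symm.trans hφs'⟩, fun g => ?_⟩
    have hx : π (φ.symm g) = p := (φ.symm g).2
    have hsymm : e.toOpenPartialHomeomorph.symm ((p : M), g) = φ.symm g := by
      have h1 : e (φ.symm g : E) = ((p : M), g) :=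
        Prod.ext ((e.coe_fst' (by rw [hx]; exact p.2.1)).trans hx)
          (by rw [← hφ, MulEquiv.apply_symm_apply])
      rw [← h1]
      exact e.left_inv (e.mem_source.2 (by rw [hx]; exact p.2.1))
    rw [hsymm]
    exact Prod.ext ((e'.coe_fst' (by rw [hx]; exact p.2.2)).trans hx) (hφ' _).symm
  choose τ hτ using key
  exact ⟨τ, hτ⟩

end SmoothTransition

end SLG

end

/-- The two equivalences correspond to the two readings of "transition functions with values in
the Lie group `Aut(G, θ)`": as plain functions, and as smooth maps of manifolds. -/
theorem theorem4p7
    {VG : Type*} [NormedAddCommGroup VG] [NormedSpace ℝ VG] [FiniteDimensional ℝ VG]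
    {G : Type*} [TopologicalSpace G] [ChartedSpace VG G] [Group G] [LieGroup 𝓘(ℝ, VG) ∞ G]
    [ConnectedSpace G]
    (θ : SLG.BilinField VG G) (hθ : SLG.IsLeftInvariantSymplectic θ)
    {VM : Type*} [NormedAddCommGroup VM] [NormedSpace ℝ VM] [FiniteDimensional ℝ VM]
    {M : Type*} [TopologicalSpace M] [ChartedSpace VM M] [IsManifold 𝓘(ℝ, VM) ∞ M]
    {VE : Type*} [NormedAddCommGroup VE] [NormedSpace ℝ VE] [FiniteDimensional ℝ VE]
    {E : Type*} [TopologicalSpace E] [ChartedSpace VE E] [IsManifold 𝓘(ℝ, VE) ∞ E]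
    (π : E → M) (hπ : SLG.IsSmoothFiberBundle VG G VM VE π) :
    (Nonempty (SLG.SLGBStructure θ π hπ) ↔
      ∃ A : Set (Bundle.Trivialization G π), SLG.IsTrivSystem VG VM VE A ∧
        ∀ e ∈ A, ∀ e' ∈ A,
          ∃ τ : (e.baseSet ∩ e'.baseSet : Set M) → SLG.symplecticAut θ,
            SLG.IsTransitionFunction e e' τ) ∧
    (Nonempty (SLG.SLGBStructure θ π hπ) ↔
      ∃ A : Set (Bundle.Trivialization G π), SLG.IsTrivSystem VG VM VE A ∧
        ∀ e ∈ A, ∀ e' ∈ A,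
          ∃ τ : (e.baseSet ∩ e'.baseSet : Set M) → SLG.symplecticAut θ,
            SLG.IsTransitionFunction e e' τ ∧
            SLG.IsSmoothIntoAut (VM := VM) _ (e.open_baseSet.inter e'.open_baseSet) τ) := by
  -- Two implications suffice: a bundle structure gives smooth transition functions, and merely
  -- set-theoretic ones give a bundle structure.
  have hsmooth : Nonempty (SLG.SLGBStructure θ π hπ) →
      ∃ A : Set (Bundle.Trivialization G π), SLG.IsTrivSystem VG VM VE A ∧
        ∀ e ∈ A, ∀ e' ∈ A,
          ∃ τ : (e.baseSet ∩ e'.baseSet : Set M) → SLG.symplecticAut θ,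
            SLG.IsTransitionFunction e e' τ ∧
            SLG.IsSmoothIntoAut (VM := VM) _ (e.open_baseSet.inter e'.open_baseSet) τ := by
    rintro ⟨S⟩
    obtain ⟨A, hA, hφ⟩ := S.exists_triv
    refine ⟨A, hA, fun e he e' he' => ?_⟩
    obtain ⟨τ, hτ⟩ := SLG.exists_isTransitionFunction S hφ he he'
    exact ⟨τ, hτ, hτ.isSmoothIntoAut (hA.smooth e he) (hA.smooth e' he')⟩
  refine ⟨⟨fun h => ?_, ?_⟩, ⟨hsmooth, ?_⟩⟩
  · obtain ⟨A, hA, hτ⟩ := hsmooth h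
    exact ⟨A, hA, fun e he e' he' => (hτ e he e' he').imp fun _ h => h.1⟩
  · rintro ⟨A, hA, hτ⟩
    exact ⟨SLG.SLGBStructure.ofTrivSystem hθ hπ hA hτ⟩
  · rintro ⟨A, hA, hτ⟩
    exact ⟨SLG.SLGBStructure.ofTrivSystem hθ hπ hA fun e he e' he' =>
      (hτ e he e' he').imp fun _ h => h.1⟩
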